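/- Trees are finite rooted (non-planar) trees, i.e. objects of the category $\Omega$; a vertex without inputs is called bald, and a tree is open if it has no bald vertices. For a tree $T$, $\Omega(T)$ is the free coloured operad on $T$, whose operations are the subtrees of $T$. A face of $T$ (of any codimension) is a subobject $F\rightarrowtail T$ in $\Omega$. A shuffle of $S\otimes T$ is a tree $A$ with edges in $E(S)\times E(T)$, with root edge the pair of root edges and with all leaves pairs of leaves, in which every vertex is of the form $v\otimes t$ (output $(s,t)$, inputs $(c,t)$ for the inputs $c$ of the vertex $v$ of $S$ with output $s$) or $s\otimes w$ (output $(s,t)$, inputs $(s,d)$ for the inputs $d$ of the vertex $w$ of $T$ with output $t$). It is a subobject of $S\otimes T$, the nerve of the Boardman–Vogt tensor product $\Omega(S)\otimes\Omega(T)$. For a face $R$ of $T$, a face $F$ of a shuffle $A$ of $S\otimes T$ is said to be contained in $S\otimes R$ if there is a shuffle $B$ of $S\otimes R$ having $F$ as a face such that the maps $F\to A\to S\otimes T$ and $F\to B\to S\otimes R\to S\otimes T$ are equal. For an edge $y$ of $T$, the forest $D_yT$ is defined as follows. If $y$ is internal, $D_yT=\partial_yT$ is the tree obtained by contracting $y$.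 If $y$ is a leaf attached to a vertex $v$ with inputs $y,y_1,\dots,y_n$, then $D_yT=T/y_1+\dots+T/y_n+v/T$, where $T/z$ is the subtree of $T$ with root edge $z$ consisting of everything above $z$, and $v/T$ is the component of $T-v$ containing the root edge. If $y$ is the root edge and $x_1,\dots,x_n$ are the inputs of the root vertex, then $D_yT=T/x_1+\dots+T/x_n$. (If $T$ consists of the single edge $y$, then $D_yT$ is empty.) Lemma. (1) Let $S$ and $T$ be trees with $S$ open, let $y$ be an edge of $T$, let $A$ be a shuffle of $S\otimes T$, and let $F$ be a face of $A$ none of whose edges is of the form $(s,y)$. Then $F$ is contained in $S\otimes D_yT$, that is, in $S\otimes R$ for some connected component $R$ of $D_yT$. (2) The openness assumption cannot be dropped: there are trees $S$, $T$ with $S$ not open, an edge $y$ of $T$, a shuffle $A$ of $S\otimes T$ and a face $F$ of $A$ none of whose edges is of the form $(s,y)$, such that $F$ is not contained in $S\otimes R$ for any connected component $R$ of $D_yT$. -/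

import Mathlib

namespace Dendro

open Relation

universe u v

/-- A finite rooted non-planar tree (an object of the category `Ω`) with edges in an ambient
type `E`.  Every vertex has exactly one output edge, so vertices are identified with their
output edges: `vert` is the set of those edges which have a vertex on top, and `In e c` says
that `c` is an input edge of the vertex with output edge `e`.  A vertex may have no inputs at all
(a bald vertex, or stump); the edges not in `vert` are the leaves. -/
@[ext]
structure RTree (E : Type u) where
  edges : Set E
  finite_edges : edges.Finite
  root : E
  root_mem : root ∈ edges
  vert : Set E
  vert_subset : vert ⊆ edges
  In : E → E → Prop
  mem_vert_of_In : ∀ {e c}, In e c → e ∈ vert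
  mem_edges_of_In : ∀ {e c}, In e c → c ∈ edges
  In_unique : ∀ {e e' c}, In e c → In e' c → e = e'
  not_In_root : ∀ e, ¬ In e root
  reach : ∀ e ∈ edges, ReflTransGen In root e

namespace RTree

variable {E : Type u}

/-- `y` is a leaf of `T`. -/
def IsLeaf (T : RTree E) (y : E) : Prop := y ∈ T.edges ∧ y ∉ T.vert

/-- `y` is an internal edge of `T`: it has a vertex at both of its ends. -/
def IsInternal (T : RTree E) (y : E) : Prop := y ∈ T.vert ∧ y ≠ T.root

/-- A tree is open if it has no bald vertices. -/
def IsOpen (T : RTree E) : Prop := ∀ e ∈ T.vert, ∃ c, T.In e c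

/-- The operations of the free operad `Ω(T)` with output `e`, up to the (free) permutation of
their inputs: the subtrees of `T` with root edge `e`, all inputs of a vertex being retained
together with that vertex.  `edge e` is the identity operation of `e`. -/
inductive Op (T : RTree E) : E → Type u
  | edge (e : E) : Op T e
  | node {e : E} (h : e ∈ T.vert) (f : ∀ c, T.In e c → Op T c) : Op T e

/-- The set of inputs of an operation, i.e. of leaves of the corresponding subtree. -/
def Op.leaves {T : RTree E} : ∀ {e : E}, T.Op e → Set E
  | _, .edge e => {e}
  | _, .node _ f => {x | ∃ c, ∃ h : T.In _ c, x ∈ (f c h).leaves}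

/-- `F` is a face (of arbitrary codimension, possibly zero) of `T`, as a subobject of `T` in `Ω`:
the edges of `F` are edges of `T`, and every vertex of `F` is an operation of `Ω(T)`. -/
structure IsFace (F T : RTree E) : Prop where
  edges_subset : F.edges ⊆ T.edges
  exists_op : ∀ e ∈ F.vert, ∃ o : T.Op e, o.leaves = {c | F.In e c}

/-- The operation of `Ω(T)` given by a vertex of a face. -/
noncomputable def IsFace.op {F T : RTree E} (hF : F.IsFace T) (e : E) (he : e ∈ F.vert) :
    T.Op e := (hF.exists_op e he).choose

theorem IsFace.leaves_op {F T : RTree E} (hF : F.IsFace T) (e : E) (he : e ∈ F.vert) :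
    (hF.op e he).leaves = {c | F.In e c} := (hF.exists_op e he).choose_spec

theorem acyclic (T : RTree E) {e : E} (he : e ∈ T.edges) : ¬ TransGen T.In e e := by
  have h := T.reach e he
  induction h with
  | refl =>
    intro h
    obtain ⟨b, -, hb⟩ := TransGen.tail'_iff.1 h
    exact T.not_In_root _ hb
  | @tail b c hb hbc ih =>
    intro h
    obtain ⟨b', hb', hb'c⟩ := TransGen.tail'_iff.1 h
    have := T.In_unique hbc hb'c
    subst this
    exact ih (T.vert_subset (T.mem_vert_of_In hbc)) (TransGen.head' hbc hb')

theorem mem_edges_of_reach (T : RTree E) {z e : E} (hz : z ∈ T.edges)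
    (h : ReflTransGen T.In z e) : e ∈ T.edges := by
  induction h with
  | refl => exact hz
  | tail _ h _ => exact T.mem_edges_of_In h

/-- `T/z`: the subtree of `T` with root edge `z` consisting of everything above `z`. -/
def above (T : RTree E) (z : E) (hz : z ∈ T.edges) : RTree E where
  edges := {e | ReflTransGen T.In z e}
  finite_edges := T.finite_edges.subset fun _ h => T.mem_edges_of_reach hz h
  root := z
  root_mem := ReflTransGen.refl
  vert := {e | e ∈ T.vert ∧ ReflTransGen T.In z e}
  vert_subset := fun _ h => h.2
  In e c := T.In e c ∧ ReflTransGen T.In z e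
  mem_vert_of_In h := ⟨T.mem_vert_of_In h.1, h.2⟩
  mem_edges_of_In h := h.2.tail h.1
  In_unique h h' := T.In_unique h.1 h'.1
  not_In_root _ h := T.acyclic hz (TransGen.tail' h.2 h.1)
  reach e he := by
    have he' : ReflTransGen T.In z e := he
    clear he
    induction he' with
    | refl => exact ReflTransGen.refl
    | tail hb hbc ih => exact ih.tail ⟨hbc, hb⟩

/-- `v/T`, where `v` is the vertex with output edge `x`: the part of `T` which remains around the
root when `v` is removed together with everything above it, so that `x` becomes a leaf. -/
def below (T : RTree E) (x : E) (_hx : x ∈ T.vert) : RTree E where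
  edges := {e | e ∈ T.edges ∧ ¬ TransGen T.In x e}
  finite_edges := T.finite_edges.subset fun _ h => h.1
  root := T.root
  root_mem := ⟨T.root_mem, fun h => by
    obtain ⟨b, -, hb⟩ := TransGen.tail'_iff.1 h
    exact T.not_In_root _ hb⟩
  vert := {e | e ∈ T.vert ∧ ¬ ReflTransGen T.In x e}
  vert_subset := fun _ h => ⟨T.vert_subset h.1, fun h' => h.2 h'.to_reflTransGen⟩
  In e c := T.In e c ∧ ¬ ReflTransGen T.In x e
  mem_vert_of_In h := ⟨T.mem_vert_of_In h.1, h.2⟩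
  mem_edges_of_In h := ⟨T.mem_edges_of_In h.1, fun h' => by
    obtain ⟨b, hb, hbc⟩ := TransGen.tail'_iff.1 h'
    rw [← T.In_unique h.1 hbc] at hb
    exact h.2 hb⟩
  In_unique h h' := T.In_unique h.1 h'.1
  not_In_root _ h := T.not_In_root _ h.1
  reach e he := by
    have hr := T.reach e he.1
    have hn := he.2
    clear he
    induction hr with
    | refl => exact ReflTransGen.refl
    | tail hb hbc ih =>
      have h1 : ¬ ReflTransGen T.In x _ := fun h => hn (TransGen.tail' h hbc)
      exact (ih fun h => h1 h.to_reflTransGen).tail ⟨hbc, h1⟩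

/-- `∂_y T` for an internal edge `y`: the tree obtained by contracting `y`. -/
def contract (T : RTree E) (y : E) (hy : T.IsInternal y) : RTree E where
  edges := {e | e ∈ T.edges ∧ e ≠ y}
  finite_edges := T.finite_edges.subset fun _ h => h.1
  root := T.root
  root_mem := ⟨T.root_mem, hy.2.symm⟩
  vert := {e | e ∈ T.vert ∧ e ≠ y}
  vert_subset := fun _ h => ⟨T.vert_subset h.1, h.2⟩
  In e c := e ≠ y ∧ c ≠ y ∧ (T.In e c ∨ (T.In e y ∧ T.In y c))
  mem_vert_of_In h := ⟨h.2.2.elim T.mem_vert_of_In fun h => T.mem_vert_of_In h.1, h.1⟩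
  mem_edges_of_In h := ⟨h.2.2.elim T.mem_edges_of_In fun h => T.mem_edges_of_In h.2, h.2.1⟩
  In_unique := by
    rintro e e' c ⟨he, hc, h | h⟩ ⟨he', -, h' | h'⟩
    · exact T.In_unique h h'
    · exact absurd (T.In_unique h h'.2) he
    · exact absurd (T.In_unique h' h.2) he'
    · exact T.In_unique h.1 h'.1
  not_In_root _ h := h.2.2.elim (T.not_In_root _) fun h => T.not_In_root _ h.2
  reach e he := by
    suffices H : (e ≠ y → ReflTransGen (fun e c => e ≠ y ∧ c ≠ y ∧
        (T.In e c ∨ (T.In e y ∧ T.In y c))) T.root e) ∧ (e = y → ∃ p, p ≠ y ∧ T.In p y ∧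
        ReflTransGen (fun e c => e ≠ y ∧ c ≠ y ∧
        (T.In e c ∨ (T.In e y ∧ T.In y c))) T.root p) from H.1 he.2
    have hr := T.reach e he.1
    clear he
    induction hr with
    | refl => exact ⟨fun _ => ReflTransGen.refl, fun h => absurd h.symm hy.2⟩
    | @tail b c hb hbc ih =>
      have key : c = y → b ≠ y := by
        rintro rfl rfl
        exact T.acyclic (T.mem_edges_of_In hbc) (TransGen.single hbc)
      refine ⟨fun hc => ?_, fun hc => ?_⟩
      · by_cases hby : b = y
        · obtain ⟨p, hp, hpy, hrp⟩ := ih.2 hby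
          subst hby
          exact hrp.tail ⟨hp, hc, Or.inr ⟨hpy, hbc⟩⟩
        · exact (ih.1 hby).tail ⟨hby, hc, Or.inl hbc⟩
      · have hb' := key hc
        subst hc
        exact ⟨b, hb', hbc, ih.1 hb'⟩

/-- `T.IsComponentD y R` says that the tree `R` is a connected component of the forest `D_y T`:
* if `y` is an internal edge, `D_y T` is the tree `∂_y T`;
* if `y` is a leaf, attached to the vertex `v` with output edge `x`, then `D_y T` is the sum
  of the trees `T/z` for the siblings `z` of `y` and of `v/T`;
* if `y` is the root edge, `D_y T` is the sum of the trees `T/z` for the inputs `z` of the root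
  vertex. -/
inductive IsComponentD (T : RTree E) (y : E) : RTree E → Prop
  | internal (hy : T.IsInternal y) : IsComponentD T y (T.contract y hy)
  | sibling (hy : T.IsLeaf y) {x z : E} (hx : T.In x y) (hz : T.In x z) (hzy : z ≠ y) :
      IsComponentD T y (T.above z (T.mem_edges_of_In hz))
  | base (hy : T.IsLeaf y) {x : E} (hx : T.In x y) :
      IsComponentD T y (T.below x (T.mem_vert_of_In hx))
  | input (hy : y = T.root) {z : E} (hz : T.In y z) :
      IsComponentD T y (T.above z (T.mem_edges_of_In hz))

/-- The operation of `Ω(T)` given by a single vertex of `T`. -/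
def Op.corolla {T : RTree E} {e : E} (h : e ∈ T.vert) : T.Op e := .node h fun c _ => .edge c

theorem Op.leaves_corolla {T : RTree E} {e : E} (h : e ∈ T.vert) :
    (Op.corolla h).leaves = {c | T.In e c} := by
  ext x
  simp [corolla, leaves]

theorem isFace_above (T : RTree E) (z : E) (hz : z ∈ T.edges) : (T.above z hz).IsFace T where
  edges_subset _ h := T.mem_edges_of_reach hz h
  exists_op e he := ⟨.corolla he.1, by
    rw [Op.leaves_corolla]; ext c; exact ⟨fun h => ⟨h, he.2⟩, fun h => h.1⟩⟩

theorem isFace_below (T : RTree E) (x : E) (hx : x ∈ T.vert) : (T.below x hx).IsFace T where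
  edges_subset _ h := h.1
  exists_op e he := ⟨.corolla he.1, by
    rw [Op.leaves_corolla]; ext c; exact ⟨fun h => ⟨h, he.2⟩, fun h => h.1⟩⟩

open Classical in
theorem isFace_contract (T : RTree E) (y : E) (hy : T.IsInternal y) :
    (T.contract y hy).IsFace T where
  edges_subset _ h := h.1
  exists_op e he := by
    refine ⟨.node he.1 fun c _ => if h : c ∈ T.vert ∧ c = y then .corolla h.1 else .edge c, ?_⟩
    ext d
    simp only [Op.leaves, Set.mem_ofPred_eq]
    constructor
    · rintro ⟨c, hc, hd⟩
      split_ifs at hd with h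
      · rw [Op.leaves_corolla] at hd
        obtain ⟨-, rfl⟩ := h
        refine ⟨he.2, ?_, Or.inr ⟨hc, hd⟩⟩
        rintro rfl
        exact T.acyclic (T.mem_edges_of_In hc) (TransGen.single hd)
      · simp only [Op.leaves, Set.mem_singleton_iff] at hd
        subst hd
        refine ⟨he.2, ?_, Or.inl hc⟩
        rintro rfl
        exact h ⟨hy.1, rfl⟩
    · rintro ⟨-, hd, h | h⟩
      · refine ⟨d, h, ?_⟩
        rw [dif_neg fun h' => hd h'.2]
        rfl
      · refine ⟨y, h.1, ?_⟩
        rw [dif_pos ⟨hy.1, rfl⟩, Op.leaves_corolla]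
        exact h.2

theorem IsComponentD.isFace {T R : RTree E} {y : E} (h : T.IsComponentD y R) : R.IsFace T := by
  cases h with
  | internal hy => exact T.isFace_contract y hy
  | sibling _ _ hz _ => exact T.isFace_above _ _
  | base _ hx => exact T.isFace_below _ _
  | input _ hz => exact T.isFace_above _ _

end RTree

open RTree

variable {ES : Type u} {ET : Type v}

/-- Formal composites with output colour `(s, t)` of the generating operations of the
Boardman-Vogt tensor product `Ω(S) ⊗ Ω(T)`, again up to the (free) permutation of inputs.
The generators are `v ⊗ t` (`nodeS`; `v` a vertex of `S`, `t` an edge of `T`) and `s ⊗ w`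
(`nodeT`; `s` an edge of `S`, `w` a vertex of `T`); `edge s t` is an identity operation. -/
inductive BVTerm (S : RTree ES) (T : RTree ET) : ES → ET → Type (max u v)
  | edge (s : ES) (t : ET) : BVTerm S T s t
  | nodeS {s : ES} {t : ET} (h : s ∈ S.vert) (f : ∀ c, S.In s c → BVTerm S T c t) :
      BVTerm S T s t
  | nodeT {s : ES} {t : ET} (h : t ∈ T.vert) (f : ∀ d, T.In t d → BVTerm S T s d) :
      BVTerm S T s t

/-- The congruence generated by the Boardman-Vogt interchange relation. -/
inductive BVRel (S : RTree ES) (T : RTree ET) :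
    ∀ {s : ES} {t : ET}, BVTerm S T s t → BVTerm S T s t → Prop
  | refl {s : ES} {t : ET} (a : BVTerm S T s t) : BVRel S T a a
  | symm {s : ES} {t : ET} {a b : BVTerm S T s t} : BVRel S T a b → BVRel S T b a
  | trans {s : ES} {t : ET} {a b c : BVTerm S T s t} :
      BVRel S T a b → BVRel S T b c → BVRel S T a c
  | congrS {s : ES} {t : ET} (h : s ∈ S.vert) {f g : ∀ c, S.In s c → BVTerm S T c t} :
      (∀ c hc, BVRel S T (f c hc) (g c hc)) → BVRel S T (.nodeS h f) (.nodeS h g)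
  | congrT {s : ES} {t : ET} (h : t ∈ T.vert) {f g : ∀ d, T.In t d → BVTerm S T s d} :
      (∀ d hd, BVRel S T (f d hd) (g d hd)) → BVRel S T (.nodeT h f) (.nodeT h g)
  | interchange {s : ES} {t : ET} (hs : s ∈ S.vert) (ht : t ∈ T.vert)
      (f : ∀ c, S.In s c → ∀ d, T.In t d → BVTerm S T c d) :
      BVRel S T (.nodeS hs fun c hc => .nodeT ht fun d hd => f c hc d hd)
        (.nodeT ht fun d hd => .nodeS hs fun c hc => f c hc d hd)

/-- The operations of `Ω(S) ⊗ Ω(T)` with output colour `(s, t)`. -/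
def TensorOp (S : RTree ES) (T : RTree ET) (s : ES) (t : ET) : Type (max u v) :=
  Quot (BVRel S T (s := s) (t := t))

/-- The composite of `s ⊗ o`, for an operation `o` of `Ω(T)`, with an operation on each input. -/
def BVTerm.graftT {S : RTree ES} {T : RTree ET} (s : ES) :
    ∀ {t : ET} (o : T.Op t), (∀ d, d ∈ o.leaves → BVTerm S T s d) → BVTerm S T s t
  | _, .edge t, g => g t rfl
  | _, .node h f, g => .nodeT h fun d hd => graftT s (f d hd) fun x hx => g x ⟨d, hd, hx⟩

/-- The map `S ⊗ R → S ⊗ T` induced by a face `R` of `T`, on formal composites. -/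
noncomputable def BVTerm.map {S : RTree ES} {R T : RTree ET} (hR : R.IsFace T) :
    ∀ {s : ES} {t : ET}, BVTerm S R s t → BVTerm S T s t
  | _, _, .edge s t => .edge s t
  | _, _, .nodeS h f => .nodeS h fun c hc => (f c hc).map hR
  | s, t, .nodeT h f => graftT s (hR.op t h) fun d hd =>
      (f d (by rw [hR.leaves_op] at hd; exact hd)).map hR

theorem BVRel.graftT_congr {S : RTree ES} {T : RTree ET} (s : ES) {t : ET} (o : T.Op t)
    (g g' : ∀ d, d ∈ o.leaves → BVTerm S T s d) (h : ∀ d hd, BVRel S T (g d hd) (g' d hd)) :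
    BVRel S T (BVTerm.graftT s o g) (BVTerm.graftT s o g') := by
  induction o with
  | edge t => exact h _ _
  | node ht f ih => exact .congrT ht fun d hd => ih d hd _ _ fun x hx => h _ _

theorem BVRel.graftT_interchange {S : RTree ES} {T : RTree ET} {s : ES} (hs : s ∈ S.vert)
    {t : ET} (o : T.Op t) (g : ∀ c, S.In s c → ∀ d, d ∈ o.leaves → BVTerm S T c d) :
    BVRel S T (.nodeS hs fun c hc => BVTerm.graftT c o (g c hc))
      (BVTerm.graftT s o fun d hd => .nodeS hs fun c hc => g c hc d hd) := by
  induction o with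
  | edge t => exact .refl _
  | node ht f ih =>
    exact (BVRel.interchange hs ht _).trans
      (.congrT ht fun d hd => ih d hd fun c hc x hx => g c hc x ⟨d, hd, hx⟩)

theorem BVRel.map {S : RTree ES} {R T : RTree ET} (hR : R.IsFace T) {s : ES} {t : ET}
    {a b : BVTerm S R s t} (h : BVRel S R a b) : BVRel S T (a.map hR) (b.map hR) := by
  induction h with
  | refl a => exact .refl _
  | symm _ ih => exact ih.symm
  | trans _ _ ih ih' => exact ih.trans ih'
  | congrS h _ ih => exact .congrS h ih
  | congrT h _ ih => exact graftT_congr _ _ _ _ fun d hd => ih d _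
  | interchange hs ht f => exact graftT_interchange hs (hR.op _ ht) _

/-- The map `S ⊗ R → S ⊗ T` induced by a face `R` of `T`, on operations. -/
noncomputable def TensorOp.map {S : RTree ES} {R T : RTree ET} (hR : R.IsFace T)
    {s : ES} {t : ET} : TensorOp S R s t → TensorOp S T s t :=
  Quot.map (BVTerm.map hR) fun _ _ h => h.map hR

/-- The vertex of `A` with output edge `p` is of the form `v ⊗ t`. -/
def IsSVertex (S : RTree ES) (A : RTree (ES × ET)) (p : ES × ET) : Prop :=
  p.1 ∈ S.vert ∧ ∀ q, A.In p q ↔ S.In p.1 q.1 ∧ q.2 = p.2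

/-- The vertex of `A` with output edge `p` is of the form `s ⊗ w`. -/
def IsTVertex (T : RTree ET) (A : RTree (ES × ET)) (p : ES × ET) : Prop :=
  p.2 ∈ T.vert ∧ ∀ q, A.In p q ↔ q.1 = p.1 ∧ T.In p.2 q.2

/-- `A` is a shuffle of `S ⊗ T`: a tree with edges in `Edges(S) × Edges(T)`, from the pair of
roots up to pairs of leaves, each of whose vertices is of the form `v ⊗ t` or `s ⊗ w`. -/
structure IsShuffle (S : RTree ES) (T : RTree ET) (A : RTree (ES × ET)) : Prop where
  root_eq : A.root = (S.root, T.root)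
  leaf : ∀ p, A.IsLeaf p → S.IsLeaf p.1 ∧ T.IsLeaf p.2
  vertex : ∀ p ∈ A.vert, IsSVertex S A p ∨ IsTVertex T A p

open Classical in
/-- The inclusion `A ⊆ S ⊗ T` of a shuffle, on operations of `Ω(A)`.  (A bald vertex of `A` can be
both of the form `v ⊗ t` and `s ⊗ w`; these are then equal in `Ω(S) ⊗ Ω(T)`.) -/
noncomputable def IsShuffle.toTerm {S : RTree ES} {T : RTree ET} {A : RTree (ES × ET)}
    (hA : IsShuffle S T A) : ∀ {p : ES × ET}, A.Op p → BVTerm S T p.1 p.2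
  | _, .edge p => .edge p.1 p.2
  | p, .node h f =>
    if hS : IsSVertex S A p then
      .nodeS hS.1 fun c hc => hA.toTerm (f (c, p.2) ((hS.2 (c, p.2)).2 ⟨hc, rfl⟩))
    else
      have hT : IsTVertex T A p := (hA.vertex p h).resolve_left hS
      .nodeT hT.1 fun d hd => hA.toTerm (f (p.1, d) ((hT.2 (p.1, d)).2 ⟨rfl, hd⟩))

/-- The composite `F → A → S ⊗ T`, for a face `F` of a shuffle `A` of `S ⊗ T`.  On edges it is the
inclusion of `Edges(F)` in `Edges(S) × Edges(T)`; this is its value on the vertices of `F`. -/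
noncomputable def IsShuffle.faceOp {S : RTree ES} {T : RTree ET} {A F : RTree (ES × ET)}
    (hA : IsShuffle S T A) (hF : F.IsFace A) (e : ES × ET) (he : e ∈ F.vert) :
    TensorOp S T e.1 e.2 :=
  Quot.mk _ (hA.toTerm (hF.op e he))

/-- For a face `F` of a shuffle `A` of `S ⊗ T` and a face `R` of `T`: the subobject `F` of `S ⊗ T`
is contained in `S ⊗ R`, i.e. the map `F → A → S ⊗ T` is equal to a composite
`F → B → S ⊗ R → S ⊗ T` in which `F` is a face of a shuffle `B` of `S ⊗ R`. -/
def ContainedIn {S : RTree ES} {T : RTree ET} {A F : RTree (ES × ET)}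
    (hA : IsShuffle S T A) (hF : F.IsFace A) {R : RTree ET} (hR : R.IsFace T) : Prop :=
  ∃ (B : RTree (ES × ET)) (hB : IsShuffle S R B) (hFB : F.IsFace B),
    ∀ e he, hA.faceOp hF e he = (hB.faceOp hFB e he).map hR

/-- For a face `F` of a shuffle `A` of `S ⊗ T`: the subobject `F` of `S ⊗ T` is contained in
`S ⊗ D_y T`, i.e. in `S ⊗ R` for some connected component `R` of `D_y T`. -/
def ContainedInD {S : RTree ES} {T : RTree ET} {A F : RTree (ES × ET)}
    (hA : IsShuffle S T A) (hF : F.IsFace A) (y : ET) : Prop :=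
  ∃ (R : RTree ET) (hR : T.IsComponentD y R), ContainedIn hA hF hR.isFace

end Dendro

/-!
Let `S` be open, let `A` be a shuffle of `S ⊗ T`, and let `F` be a face of `A` which avoids the
column of `y`, i.e. all edges `(s, y)`.

An operation of `Ω(S) ⊗ Ω(T)` is determined by its output and its inputs (`BVRel.of_leaves_eq`): if
all inputs of a composite lie above a vertex `v` of `S`, the interchange relation moves `v` to the
root (`BVTerm.exists_nodeS`), and likewise for `T`, so that two composites with the same inputs can
be given the same root vertex.  Hence `F` is contained in `S ⊗ R` as soon as `F` is a face of some
shuffle `B` of `S ⊗ R` (`ContainedIn.of_isFace`): every operation of `A` occurring in `F` has to be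
replaced by an operation of `B` with the same inputs.

The shuffle `B` is described in the same way for each component `R` of `D_y T`.  Growing upwards
from the pair of roots, it has a vertex of `R` on top of `(s, t)` if `A` has a vertex of the form
`s ⊗ w` there, and a vertex of `S` otherwise, as far as these exist in `R` and `S` (`shuffleOf`).

* If `R = T/z`, then `B` starts with vertices of `S`, until it meets the edges `(s, z)` of `A`; from
  there on it agrees with `A`.  This serves for `y` the root edge, and for `y` a leaf attached to the
  vertex `v` when the root of `F` lies above `v`.
* If `R = v/T` and the root of `F` does not lie above `v`, then no vertex `s ⊗ v` occurs in an
  operation of `F`: such an operation would contain the edge `(s, y)` and hence, as `S` is open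
  and `y` is a leaf, have an input in the column of `y`.  Away from these vertices `A` and `B` agree.
* If `R = ∂_y T`, the vertex on top of `y` is applied in `B` at the moment when `A` reaches the column
  of `y`.  An operation of `F` which enters this column also leaves it again everywhere, as none of
  its inputs lies there.

Without openness, the column of `y` can be closed off by a bald vertex of `S`.  If `T` is the
binary corolla with leaves `y` and `z`, and `S` is a single bald vertex, the shuffle with the
binary vertex at the root has a face with edges over the root of `T` and over `z`, which lie in
different components of `D_y T`.
-/

namespace Dendro

open Relation

universe u v

/-! ### Trees and leaf sets of their operations -/

namespace RTree

variable {E : Type u}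

theorem reach_total (T : RTree E) {a b m : E} (ha : ReflTransGen T.In a m)
    (hb : ReflTransGen T.In b m) : ReflTransGen T.In a b ∨ ReflTransGen T.In b a := by
  rw [← reflTransGen_swap] at ha hb
  have hU : Relator.RightUnique (Function.swap T.In) := fun _ _ _ h h' => T.In_unique h h'
  exact (ReflTransGen.total_of_right_unique hU ha hb).symm.imp reflTransGen_swap.1
    reflTransGen_swap.1

theorem not_reach_of_In (T : RTree E) {s c : E} (h : T.In s c) : ¬ ReflTransGen T.In c s :=
  fun h' => T.acyclic (T.vert_subset (T.mem_vert_of_In h)) (TransGen.head' h h')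

theorem ne_of_In (T : RTree E) {s c : E} (h : T.In s c) : s ≠ c := by
  rintro rfl
  exact T.not_reach_of_In h .refl

theorem In_right_unique_of_reach (T : RTree E) {s c c' m : E} (h : T.In s c) (h' : T.In s c')
    (hc : ReflTransGen T.In c m) (hc' : ReflTransGen T.In c' m) : c = c' := by
  wlog hcc : ReflTransGen T.In c c' generalizing c c'
  · exact (this h' h hc' hc ((T.reach_total hc hc').resolve_left hcc)).symm
  rcases ReflTransGen.cases_tail hcc with h0 | ⟨b, hb, hbc⟩
  · exact h0.symm
  · rw [T.In_unique hbc h'] at hb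
    exact absurd hb (T.not_reach_of_In h)

/-- `X` is the set of inputs of some operation of `Ω(T)` with output `e`. -/
inductive IsLeafSet (T : RTree E) : E → Set E → Prop
  | edge (e : E) : IsLeafSet T e {e}
  | node {e : E} (h : e ∈ T.vert) (X : E → Set E) (hX : ∀ c, T.In e c → IsLeafSet T c (X c)) :
      IsLeafSet T e {x | ∃ c, T.In e c ∧ x ∈ X c}

theorem isLeafSet_iff {T : RTree E} {e : E} {X : Set E} :
    T.IsLeafSet e X ↔ ∃ o : T.Op e, o.leaves = X := by
  constructor
  · intro h
    induction h with
    | edge e => exact ⟨.edge e, rfl⟩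
    | node h X _ ih =>
      choose f hf using ih
      refine ⟨.node h f, ?_⟩
      ext x
      constructor
      · rintro ⟨c, hc, hx⟩
        exact ⟨c, hc, hf c hc ▸ hx⟩
      · rintro ⟨c, hc, hx⟩
        exact ⟨c, hc, (hf c hc).symm ▸ hx⟩
  · rintro ⟨o, rfl⟩
    induction o with
    | edge e => exact .edge e
    | @node e h f ih =>
      have hX : ∀ c (hc : T.In e c),
          {x | ∃ h : T.In e c, x ∈ (f c h).leaves} = (f c hc).leaves := fun c hc => by
        ext x
        exact ⟨fun ⟨_, h⟩ => h, fun h => ⟨hc, h⟩⟩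
      have := IsLeafSet.node h (fun c => {x | ∃ h : T.In e c, x ∈ (f c h).leaves})
        fun c hc => (hX c hc).symm ▸ ih c hc
      convert this using 1
      ext x
      exact ⟨fun ⟨c, hc, h⟩ => ⟨c, hc, hc, h⟩, fun ⟨c, hc, _, h⟩ => ⟨c, hc, h⟩⟩

theorem IsLeafSet.reach {T : RTree E} {e : E} {X : Set E} (h : T.IsLeafSet e X) :
    ∀ x ∈ X, ReflTransGen T.In e x := by
  induction h with
  | edge e => rintro x rfl; exact .refl
  | node _ X _ ih => rintro x ⟨c, hc, hx⟩; exact .head hc (ih c hc x hx)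

theorem IsFace.isLeafSet {F T : RTree E} (hF : F.IsFace T) {e : E} (he : e ∈ F.vert) :
    T.IsLeafSet e {c | F.In e c} := isLeafSet_iff.2 (hF.exists_op e he)

theorem IsFace.of_isLeafSet {F A B : RTree E} (hF : F.IsFace A)
    (h : ∀ p ∈ F.edges, p ∈ B.edges)
    (h' : ∀ p ∈ F.vert, A.IsLeafSet p {c | F.In p c} → B.IsLeafSet p {c | F.In p c}) :
    F.IsFace B :=
  ⟨h, fun p hp => isLeafSet_iff.1 (h' p hp (hF.isLeafSet hp))⟩

theorem IsFace.reach_root {F T : RTree E} (hF : F.IsFace T) {e : E} (he : e ∈ F.edges) :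
    ReflTransGen T.In F.root e := by
  have hr := F.reach e he
  clear he
  induction hr with
  | refl => exact .refl
  | tail _ hbc ih => exact ih.trans ((hF.isLeafSet (F.mem_vert_of_In hbc)).reach _ hbc)

end RTree

open RTree

variable {ES : Type u} {ET : Type v} {S : RTree ES} {T : RTree ET}

/-! ### Operations of the tensor product are determined by their inputs -/

/-- The set of inputs of a formal composite. -/
def BVTerm.leaves : ∀ {s : ES} {t : ET}, BVTerm S T s t → Set (ES × ET)
  | _, _, .edge s t => {(s, t)}
  | s, _, .nodeS _ f => {x | ∃ c, ∃ h : S.In s c, x ∈ (f c h).leaves}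
  | _, t, .nodeT _ f => {x | ∃ d, ∃ h : T.In t d, x ∈ (f d h).leaves}

theorem BVRel.leaves_eq {s : ES} {t : ET} {a b : BVTerm S T s t} (h : BVRel S T a b) :
    a.leaves = b.leaves := by
  induction h with
  | refl => rfl
  | symm _ ih => exact ih.symm
  | trans _ _ ih ih' => exact ih.trans ih'
  | congrS h _ ih => simp only [BVTerm.leaves, ih]
  | congrT h _ ih => simp only [BVTerm.leaves, ih]
  | interchange hs ht f =>
    ext x
    constructor
    · rintro ⟨c, hc, d, hd, hx⟩
      exact ⟨d, hd, c, hc, hx⟩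
    · rintro ⟨c, hc, d, hd, hx⟩
      exact ⟨d, hd, c, hc, hx⟩

theorem BVTerm.reach_of_mem_leaves {s : ES} {t : ET} (a : BVTerm S T s t) {x : ES × ET}
    (hx : x ∈ a.leaves) : ReflTransGen S.In s x.1 ∧ ReflTransGen T.In t x.2 := by
  induction a with
  | edge s t => obtain rfl : x = (s, t) := hx; exact ⟨.refl, .refl⟩
  | nodeS h f ih =>
    obtain ⟨c, hc, hx⟩ := hx
    exact ⟨.head hc (ih c hc hx).1, (ih c hc hx).2⟩
  | nodeT h f ih =>
    obtain ⟨d, hd, hx⟩ := hx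
    exact ⟨(ih d hd hx).1, .head hd (ih d hd hx).2⟩

/-- A vertex of `S` can be moved to the root of a formal composite, past vertices of `T`, as soon
as every input of the composite lies above that vertex. -/
theorem BVTerm.exists_nodeS {s : ES} {t : ET} (a : BVTerm S T s t) (hs : s ∈ S.vert)
    (h : ∀ x ∈ a.leaves, x.1 ≠ s) :
    ∃ f : ∀ c, S.In s c → BVTerm S T c t, BVRel S T a (.nodeS hs f) := by
  induction a with
  | edge s t => exact absurd rfl (h (s, t) rfl)
  | nodeS _ f _ => exact ⟨f, .refl _⟩
  | nodeT ht g ih =>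
    choose f hf using fun d hd => ih d hd hs fun x hx => h x ⟨d, hd, hx⟩
    exact ⟨_, (BVRel.congrT ht hf).trans
      (BVRel.interchange hs ht fun c hc d hd => f d hd c hc).symm⟩

/-- A vertex of `T` can be moved to the root of a formal composite, past vertices of `S`, as soon
as every input of the composite lies above that vertex. -/
theorem BVTerm.exists_nodeT {s : ES} {t : ET} (a : BVTerm S T s t) (ht : t ∈ T.vert)
    (h : ∀ x ∈ a.leaves, x.2 ≠ t) :
    ∃ f : ∀ d, T.In t d → BVTerm S T s d, BVRel S T a (.nodeT ht f) := by
  induction a with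
  | edge s t => exact absurd rfl (h (s, t) rfl)
  | nodeT _ f _ => exact ⟨f, .refl _⟩
  | nodeS hs g ih =>
    choose f hf using fun c hc => ih c hc ht fun x hx => h x ⟨c, hc, hx⟩
    exact ⟨_, (BVRel.congrS hs hf).trans
      (BVRel.interchange hs ht fun c hc d hd => f c hc d hd)⟩

theorem BVTerm.leaves_nodeS_input {s : ES} {t : ET} (hs : s ∈ S.vert)
    (f : ∀ c, S.In s c → BVTerm S T c t) {c : ES} (hc : S.In s c) :
    (f c hc).leaves = {x ∈ (BVTerm.nodeS hs f).leaves | ReflTransGen S.In c x.1} := by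
  ext x
  constructor
  · exact fun hx => ⟨⟨c, hc, hx⟩, (reach_of_mem_leaves _ hx).1⟩
  · rintro ⟨⟨c', hc', hx⟩, hr⟩
    obtain rfl := S.In_right_unique_of_reach hc hc' hr (reach_of_mem_leaves _ hx).1
    exact hx

theorem BVTerm.leaves_nodeT_input {s : ES} {t : ET} (ht : t ∈ T.vert)
    (f : ∀ d, T.In t d → BVTerm S T s d) {d : ET} (hd : T.In t d) :
    (f d hd).leaves = {x ∈ (BVTerm.nodeT ht f).leaves | ReflTransGen T.In d x.2} := by
  ext x
  constructor
  · exact fun hx => ⟨⟨d, hd, hx⟩, (reach_of_mem_leaves _ hx).2⟩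
  · rintro ⟨⟨d', hd', hx⟩, hr⟩
    obtain rfl := T.In_right_unique_of_reach hd hd' hr (reach_of_mem_leaves _ hx).2
    exact hx

theorem BVTerm.fst_ne_of_mem_leaves_nodeS {s : ES} {t : ET} {hs : s ∈ S.vert}
    {f : ∀ c, S.In s c → BVTerm S T c t} : ∀ x ∈ (BVTerm.nodeS hs f).leaves, x.1 ≠ s := by
  rintro x ⟨c, hc, hx⟩ rfl
  exact S.not_reach_of_In hc (reach_of_mem_leaves _ hx).1

theorem BVTerm.snd_ne_of_mem_leaves_nodeT {s : ES} {t : ET} {ht : t ∈ T.vert}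
    {f : ∀ d, T.In t d → BVTerm S T s d} : ∀ x ∈ (BVTerm.nodeT ht f).leaves, x.2 ≠ t := by
  rintro x ⟨d, hd, hx⟩ rfl
  exact T.not_reach_of_In hd (reach_of_mem_leaves _ hx).2

/-- An operation of `Ω(S) ⊗ Ω(T)` is determined by its inputs and output. -/
theorem BVRel.of_leaves_eq {s : ES} {t : ET} {a b : BVTerm S T s t}
    (h : a.leaves = b.leaves) : BVRel S T a b := by
  induction a with
  | edge s t =>
    have hb : (s, t) ∈ b.leaves := h ▸ rfl
    cases b with
    | edge => exact .refl _
    | nodeS hs f => exact absurd (Eq.refl s) (BVTerm.fst_ne_of_mem_leaves_nodeS (f := f) _ hb)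
    | nodeT ht f => exact absurd (Eq.refl t) (BVTerm.snd_ne_of_mem_leaves_nodeT (f := f) _ hb)
  | nodeS hs f ih =>
    obtain ⟨g, hg⟩ := b.exists_nodeS hs (h ▸ BVTerm.fst_ne_of_mem_leaves_nodeS)
    refine (congrS hs fun c hc => ih c hc ?_).trans hg.symm
    rw [BVTerm.leaves_nodeS_input hs f hc, BVTerm.leaves_nodeS_input hs g hc, h, hg.leaves_eq]
  | nodeT ht f ih =>
    obtain ⟨g, hg⟩ := b.exists_nodeT ht (h ▸ BVTerm.snd_ne_of_mem_leaves_nodeT)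
    refine (congrT ht fun d hd => ih d hd ?_).trans hg.symm
    rw [BVTerm.leaves_nodeT_input ht f hd, BVTerm.leaves_nodeT_input ht g hd, h, hg.leaves_eq]

theorem BVTerm.leaves_graftT (s : ES) {t : ET} (o : T.Op t)
    (g : ∀ d, d ∈ o.leaves → BVTerm S T s d) :
    (graftT s o g).leaves = {x | ∃ d, ∃ h : d ∈ o.leaves, x ∈ (g d h).leaves} := by
  induction o with
  | edge t =>
    ext x
    constructor
    · exact fun hx => ⟨t, rfl, hx⟩
    · rintro ⟨d, hd, hx⟩
      obtain rfl : d = t := hd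
      exact hx
  | node ht f ih =>
    ext x
    simp only [graftT, leaves, ih, Set.mem_ofPred_eq]
    constructor
    · rintro ⟨d, hd, e, he, hx⟩
      exact ⟨e, ⟨d, hd, he⟩, hx⟩
    · rintro ⟨e, ⟨d, hd, he⟩, hx⟩
      exact ⟨d, hd, e, he, hx⟩

theorem BVTerm.leaves_map {R : RTree ET} (hR : R.IsFace T) {s : ES} {t : ET}
    (a : BVTerm S R s t) : (a.map hR).leaves = a.leaves := by
  induction a with
  | edge => rfl
  | nodeS h f ih => simp only [map, leaves, ih]
  | nodeT h f ih =>
    ext x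
    simp only [map, leaves_graftT, leaves, ih, Set.mem_ofPred_eq]
    constructor
    · rintro ⟨d, hd, hx⟩
      exact ⟨d, by rwa [hR.leaves_op] at hd, hx⟩
    · rintro ⟨d, hd, hx⟩
      exact ⟨d, by rwa [hR.leaves_op], hx⟩

theorem IsShuffle.leaves_toTerm {A : RTree (ES × ET)} (hA : IsShuffle S T A) {p : ES × ET}
    (o : A.Op p) : (hA.toTerm o).leaves = o.leaves := by
  induction o with
  | edge p => rfl
  | @node p h f ih =>
    ext x
    rw [toTerm]
    split_ifs with hS
    · simp only [BVTerm.leaves, ih, Op.leaves, Set.mem_ofPred_eq]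
      constructor
      · rintro ⟨c, hc, hx⟩
        exact ⟨_, _, hx⟩
      · rintro ⟨⟨c, d⟩, hq, hx⟩
        obtain ⟨hc, hd⟩ := (hS.2 _).1 hq
        obtain rfl : d = p.2 := hd
        exact ⟨c, hc, hx⟩
    · have hT := (hA.vertex p h).resolve_left hS
      simp only [BVTerm.leaves, ih, Op.leaves, Set.mem_ofPred_eq]
      constructor
      · rintro ⟨c, hc, hx⟩
        exact ⟨_, _, hx⟩
      · rintro ⟨⟨c, d⟩, hq, hx⟩
        obtain ⟨hc, hd⟩ := (hT.2 _).1 hq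
        obtain rfl : c = p.1 := hc
        exact ⟨d, hd, hx⟩

/-- Containment in `S ⊗ R` is a matter of faces only: the compatibility of the two maps to `S ⊗ T`
is automatic, because operations of `Ω(S) ⊗ Ω(T)` are determined by their inputs. -/
theorem ContainedIn.of_isFace {A F B : RTree (ES × ET)} (hA : IsShuffle S T A)
    (hF : F.IsFace A) {R : RTree ET} (hR : R.IsFace T) (hB : IsShuffle S R B)
    (hFB : F.IsFace B) : ContainedIn hA hF hR := by
  refine ⟨B, hB, hFB, fun e he => Quot.sound (BVRel.of_leaves_eq ?_)⟩
  rw [BVTerm.leaves_map, hA.leaves_toTerm, hB.leaves_toTerm, hF.leaves_op, hFB.leaves_op]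

/-! ### Shuffles -/

/-- `r` is a relation on pairs of edges all of whose steps out of a given pair move the same
coordinate, up to an input edge. -/
def IsShuffleRel (S : RTree ES) (T : RTree ET) (r : ES × ET → ES × ET → Prop) : Prop :=
  ∀ p, (∀ q, r p q → S.In p.1 q.1 ∧ q.2 = p.2) ∨ (∀ q, r p q → q.1 = p.1 ∧ T.In p.2 q.2)

namespace IsShuffleRel

variable {r : ES × ET → ES × ET → Prop}

theorem reach_of_rel (h : IsShuffleRel S T r) {p q : ES × ET} (hr : r p q) :
    ReflTransGen S.In p.1 q.1 ∧ ReflTransGen T.In p.2 q.2 := by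
  rcases h p with h | h
  · exact ⟨.single (h q hr).1, (h q hr).2 ▸ .refl⟩
  · exact ⟨(h q hr).1 ▸ .refl, .single (h q hr).2⟩

theorem reach (h : IsShuffleRel S T r) {p q : ES × ET} (hr : ReflTransGen r p q) :
    ReflTransGen S.In p.1 q.1 ∧ ReflTransGen T.In p.2 q.2 := by
  induction hr with
  | refl => exact ⟨.refl, .refl⟩
  | tail _ hbc ih =>
    exact ⟨ih.1.trans (h.reach_of_rel hbc).1, ih.2.trans (h.reach_of_rel hbc).2⟩

theorem not_reach_of_rel (h : IsShuffleRel S T r) {p q : ES × ET} (hr : r p q) :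
    ¬ ReflTransGen r q p := fun hqp => by
  rcases h p with h' | h'
  · exact S.not_reach_of_In (h' q hr).1 (h.reach hqp).1
  · exact T.not_reach_of_In (h' q hr).2 (h.reach hqp).2

theorem right_unique_of_reach (h : IsShuffleRel S T r) {p q q' m : ES × ET} (hq : r p q)
    (hq' : r p q') (hS : ReflTransGen S.In q.1 m.1) (hT : ReflTransGen T.In q.2 m.2)
    (hS' : ReflTransGen S.In q'.1 m.1) (hT' : ReflTransGen T.In q'.2 m.2) : q = q' := by
  rcases h p with h | h
  · exact Prod.ext (S.In_right_unique_of_reach (h _ hq).1 (h _ hq').1 hS hS')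
      ((h _ hq).2.trans (h _ hq').2.symm)
  · exact Prod.ext ((h _ hq).1.trans (h _ hq').1.symm)
      (T.In_right_unique_of_reach (h _ hq).2 (h _ hq').2 hT hT')

/-- Two pairs which can be reached from a common pair and which have a common upper bound,
coordinate by coordinate, lie on one path. -/
theorem comparable (h : IsShuffleRel S T r) {p₀ p q m : ES × ET} (hp : ReflTransGen r p₀ p)
    (hq : ReflTransGen r p₀ q) (hpS : ReflTransGen S.In p.1 m.1)
    (hpT : ReflTransGen T.In p.2 m.2) (hqS : ReflTransGen S.In q.1 m.1)
    (hqT : ReflTransGen T.In q.2 m.2) : ReflTransGen r p q ∨ ReflTransGen r q p := by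
  induction hp with
  | refl => exact .inl hq
  | @tail b c _ hbc ih =>
    have hb := h.reach_of_rel hbc
    rcases ih (hb.1.trans hpS) (hb.2.trans hpT) with h' | h'
    · rcases ReflTransGen.cases_head h' with rfl | ⟨d, hbd, hdq⟩
      · exact .inr (.single hbc)
      · have hd := h.reach hdq
        obtain rfl := h.right_unique_of_reach hbc hbd hpS hpT (hd.1.trans hqS) (hd.2.trans hqT)
        exact .inl hdq
    · exact .inr (h'.tail hbc)

theorem left_unique (h : IsShuffleRel S T r) {p₀ e e' c : ES × ET} (he : ReflTransGen r p₀ e)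
    (he' : ReflTransGen r p₀ e') (hc : r e c) (hc' : r e' c) : e = e' := by
  wlog hee : ReflTransGen r e e' generalizing e e'
  · have h1 := h.reach_of_rel hc
    have h2 := h.reach_of_rel hc'
    exact (this he' he hc' hc
      ((h.comparable he he' h1.1 h1.2 h2.1 h2.2).resolve_left hee)).symm
  rcases ReflTransGen.cases_head hee with rfl | ⟨d, hd, hde⟩
  · rfl
  · have h1 := h.reach (hde.tail hc')
    obtain rfl := h.right_unique_of_reach hc hd .refl .refl h1.1 h1.2
    exact absurd hde (h.not_reach_of_rel hc')

end IsShuffleRel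

theorem IsShuffle.isShuffleRel {A : RTree (ES × ET)} (hA : IsShuffle S T A) :
    IsShuffleRel S T A.In := by
  intro p
  by_cases hp : p ∈ A.vert
  · exact (hA.vertex p hp).imp (fun h q => (h.2 q).1) (fun h q => (h.2 q).1)
  · exact .inl fun q hq => absurd (A.mem_vert_of_In hq) hp

theorem IsShuffle.mem_edges {A : RTree (ES × ET)} (hA : IsShuffle S T A) {p : ES × ET}
    (hp : p ∈ A.edges) : p.1 ∈ S.edges ∧ p.2 ∈ T.edges := by
  have h := hA.isShuffleRel.reach (A.reach p hp)
  rw [hA.root_eq] at h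
  exact ⟨S.mem_edges_of_reach S.root_mem h.1, T.mem_edges_of_reach T.root_mem h.2⟩

/-- The step relation of the shuffle of `S ⊗ T` which has a vertex of `T` on top of the pairs in
`τ` and a vertex of `S` on top of the other ones, as far as such vertices exist. -/
def shuffleStep (S : RTree ES) (T : RTree ET) (τ : Set (ES × ET)) (p q : ES × ET) : Prop :=
  (p.2 ∈ T.vert ∧ (p ∈ τ ∨ p.1 ∉ S.vert) ∧ q.1 = p.1 ∧ T.In p.2 q.2) ∨
    (p.1 ∈ S.vert ∧ (p ∉ τ ∨ p.2 ∉ T.vert) ∧ S.In p.1 q.1 ∧ q.2 = p.2)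

theorem isShuffleRel_shuffleStep (S : RTree ES) (T : RTree ET) (τ : Set (ES × ET)) :
    IsShuffleRel S T (shuffleStep S T τ) := by
  intro p
  by_cases h : p.2 ∈ T.vert ∧ (p ∈ τ ∨ p.1 ∉ S.vert)
  · right
    rintro q (hq | hq)
    · exact hq.2.2
    · tauto
  · left
    rintro q (hq | hq)
    · exact absurd ⟨hq.1, hq.2.1⟩ h
    · exact hq.2.2

/-- The shuffle of `S ⊗ T` which has a vertex of `T` on top of the pairs in `τ` and a vertex of
`S` on top of the other ones, as far as such vertices exist. -/
def shuffleOf (S : RTree ES) (T : RTree ET) (τ : Set (ES × ET)) : RTree (ES × ET) where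
  edges := {p | ReflTransGen (shuffleStep S T τ) (S.root, T.root) p}
  finite_edges := (S.finite_edges.prod T.finite_edges).subset fun p hp => by
    have h := (isShuffleRel_shuffleStep S T τ).reach hp
    exact ⟨S.mem_edges_of_reach S.root_mem h.1, T.mem_edges_of_reach T.root_mem h.2⟩
  root := (S.root, T.root)
  root_mem := ReflTransGen.refl
  vert := {p | ReflTransGen (shuffleStep S T τ) (S.root, T.root) p ∧
    (p.1 ∈ S.vert ∨ p.2 ∈ T.vert)}
  vert_subset _ h := h.1
  In p q := ReflTransGen (shuffleStep S T τ) (S.root, T.root) p ∧ shuffleStep S T τ p q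
  mem_vert_of_In h := ⟨h.1, h.2.elim (fun h => .inr h.1) fun h => .inl h.1⟩
  mem_edges_of_In h := h.1.tail h.2
  In_unique h h' := (isShuffleRel_shuffleStep S T τ).left_unique h.1 h'.1 h.2 h'.2
  not_In_root _ h := (isShuffleRel_shuffleStep S T τ).not_reach_of_rel h.2 h.1
  reach p hp := by
    have hp' : ReflTransGen (shuffleStep S T τ) (S.root, T.root) p := hp
    clear hp
    induction hp' with
    | refl => exact .refl
    | tail hb hbc ih => exact ih.tail ⟨hb, hbc⟩

section shuffleOf

variable {τ : Set (ES × ET)} {p : ES × ET}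

theorem shuffleOf_In_fst_iff (hp : p ∈ (shuffleOf S T τ).edges) (hS : p.1 ∈ S.vert)
    (hτ : p ∉ τ ∨ p.2 ∉ T.vert) (q : ES × ET) :
    (shuffleOf S T τ).In p q ↔ S.In p.1 q.1 ∧ q.2 = p.2 := by
  constructor
  · rintro ⟨-, h | h⟩
    · tauto
    · exact h.2.2
  · exact fun h => ⟨hp, .inr ⟨hS, hτ, h⟩⟩

theorem shuffleOf_In_snd_iff (hp : p ∈ (shuffleOf S T τ).edges) (hT : p.2 ∈ T.vert)
    (hτ : p ∈ τ ∨ p.1 ∉ S.vert) (q : ES × ET) :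
    (shuffleOf S T τ).In p q ↔ q.1 = p.1 ∧ T.In p.2 q.2 := by
  constructor
  · rintro ⟨-, h | h⟩
    · exact h.2.2
    · tauto
  · exact fun h => ⟨hp, .inl ⟨hT, hτ, h⟩⟩

theorem isShuffle_shuffleOf (S : RTree ES) (T : RTree ET) (τ : Set (ES × ET)) :
    IsShuffle S T (shuffleOf S T τ) where
  root_eq := rfl
  leaf p hp := by
    have h := (isShuffleRel_shuffleStep S T τ).reach hp.1
    exact ⟨⟨S.mem_edges_of_reach S.root_mem h.1, fun h' => hp.2 ⟨hp.1, .inl h'⟩⟩,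
      ⟨T.mem_edges_of_reach T.root_mem h.2, fun h' => hp.2 ⟨hp.1, .inr h'⟩⟩⟩
  vertex p hp := by
    by_cases h : p.2 ∈ T.vert ∧ (p ∈ τ ∨ p.1 ∉ S.vert)
    · exact .inr ⟨h.1, shuffleOf_In_snd_iff hp.1 h.1 h.2⟩
    · have hS : p.1 ∈ S.vert := by
        rcases hp.2 with h' | h' <;> tauto
      exact .inl ⟨hS, shuffleOf_In_fst_iff hp.1 hS (by tauto)⟩

theorem mem_shuffleOf_fst (hp : p ∈ (shuffleOf S T τ).edges) (hτ : p ∉ τ) {c : ES}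
    (hc : S.In p.1 c) : (c, p.2) ∈ (shuffleOf S T τ).edges :=
  mem_edges_of_In _ ((shuffleOf_In_fst_iff hp (S.mem_vert_of_In hc) (.inl hτ) _).2 ⟨hc, rfl⟩)

theorem mem_shuffleOf_snd (hp : p ∈ (shuffleOf S T τ).edges) (hτ : p ∈ τ) {d : ET}
    (hd : T.In p.2 d) : (p.1, d) ∈ (shuffleOf S T τ).edges :=
  mem_edges_of_In _ ((shuffleOf_In_snd_iff hp (T.mem_vert_of_In hd) (.inl hτ) _).2 ⟨rfl, hd⟩)

theorem isLeafSet_shuffleOf_fst (hp : p ∈ (shuffleOf S T τ).edges) (hS : p.1 ∈ S.vert)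
    (hτ : p ∉ τ) (X : ES → Set (ES × ET))
    (hX : ∀ c, S.In p.1 c → (shuffleOf S T τ).IsLeafSet (c, p.2) (X c)) :
    (shuffleOf S T τ).IsLeafSet p {x | ∃ c, S.In p.1 c ∧ x ∈ X c} := by
  have hI := shuffleOf_In_fst_iff hp hS (.inl hτ)
  convert IsLeafSet.node (T := shuffleOf S T τ) (e := p) ⟨hp, .inl hS⟩ (fun q => X q.1) ?_ using 1
  · ext x
    constructor
    · rintro ⟨c, hc, hx⟩
      exact ⟨(c, p.2), (hI _).2 ⟨hc, rfl⟩, hx⟩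
    · rintro ⟨q, hq, hx⟩
      exact ⟨q.1, ((hI q).1 hq).1, hx⟩
  · rintro ⟨c, d⟩ hq
    obtain ⟨hc, hd⟩ := (hI _).1 hq
    obtain rfl : d = p.2 := hd
    exact hX c hc

theorem isLeafSet_shuffleOf_snd (hp : p ∈ (shuffleOf S T τ).edges) (hT : p.2 ∈ T.vert)
    (hτ : p ∈ τ) (X : ET → Set (ES × ET))
    (hX : ∀ d, T.In p.2 d → (shuffleOf S T τ).IsLeafSet (p.1, d) (X d)) :
    (shuffleOf S T τ).IsLeafSet p {x | ∃ d, T.In p.2 d ∧ x ∈ X d} := by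
  have hI := shuffleOf_In_snd_iff hp hT (.inl hτ)
  convert IsLeafSet.node (T := shuffleOf S T τ) (e := p) ⟨hp, .inr hT⟩ (fun q => X q.2) ?_ using 1
  · ext x
    constructor
    · rintro ⟨d, hd, hx⟩
      exact ⟨(p.1, d), (hI _).2 ⟨rfl, hd⟩, hx⟩
    · rintro ⟨q, hq, hx⟩
      exact ⟨q.2, ((hI q).1 hq).2, hx⟩
  · rintro ⟨c, d⟩ hq
    obtain ⟨hc, hd⟩ := (hI _).1 hq
    obtain rfl : c = p.1 := hc
    exact hX d hd

end shuffleOf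

/-! ### Induction on a shuffle -/

/-- The output edges of the vertices of `A` of the form `s ⊗ w`, for `w` a vertex of `T`. -/
def tVertices (T : RTree ET) (A : RTree (ES × ET)) : Set (ES × ET) :=
  {p | p ∈ A.vert ∧ IsTVertex T A p}

namespace IsShuffle

variable {A : RTree (ES × ET)}

/-- As `S` is open, no vertex of a shuffle can be of both forms. -/
theorem notMem_tVertices (hS : S.IsOpen) {p : ES × ET} (h : IsSVertex S A p) :
    p ∉ tVertices T A := by
  rintro ⟨-, h'⟩
  obtain ⟨c, hc⟩ := hS _ h.1
  exact S.ne_of_In hc ((h'.2 (c, p.2)).1 ((h.2 _).2 ⟨hc, rfl⟩)).1.symm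

/-- Induction on the edges of a shuffle, from the root upwards. -/
theorem edges_induction (hA : IsShuffle S T A) (hS : S.IsOpen) {P : ES → ET → Prop}
    (root : P S.root T.root)
    (fst : ∀ s t c, (s, t) ∈ A.edges → IsSVertex S A (s, t) → (s, t) ∉ tVertices T A →
      S.In s c → P s t → P c t)
    (snd : ∀ s t d, (s, t) ∈ A.edges → (s, t) ∈ tVertices T A → T.In t d → P s t → P s d)
    {s : ES} {t : ET} (hp : (s, t) ∈ A.edges) : P s t := by
  suffices H : ∀ p, ReflTransGen A.In A.root p → P p.1 p.2 from H _ (A.reach _ hp)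
  intro p hp
  induction hp with
  | refl => rw [hA.root_eq]; exact root
  | @tail b c _ hbc ih =>
    have hb := A.mem_vert_of_In hbc
    rcases hA.vertex b hb with h | h
    · obtain ⟨h1, h2⟩ := (h.2 c).1 hbc
      rw [h2]
      exact fst _ _ _ (A.vert_subset hb) h (notMem_tVertices hS h) h1 ih
    · obtain ⟨h1, h2⟩ := (h.2 c).1 hbc
      rw [h1]
      exact snd _ _ _ (A.vert_subset hb) ⟨hb, h⟩ h2 ih

/-- Induction on the operations of a shuffle, given by their outputs and inputs. -/
theorem isLeafSet_induction (hA : IsShuffle S T A) (hS : S.IsOpen)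
    {P : ES → ET → Set (ES × ET) → Prop}
    (edge : ∀ s t, (s, t) ∈ A.edges → P s t {(s, t)})
    (fst : ∀ s t (X : ES → Set (ES × ET)), (s, t) ∈ A.edges →
      IsSVertex S A (s, t) → (s, t) ∉ tVertices T A →
      (∀ c, S.In s c → P c t (X c)) → P s t {x | ∃ c, S.In s c ∧ x ∈ X c})
    (snd : ∀ s t (X : ET → Set (ES × ET)), (s, t) ∈ A.edges → (s, t) ∈ tVertices T A →
      (∀ d, T.In t d → P s d (X d)) → P s t {x | ∃ d, T.In t d ∧ x ∈ X d})
    {p : ES × ET} (hp : p ∈ A.edges) {X : Set (ES × ET)} (hX : A.IsLeafSet p X) :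
    P p.1 p.2 X := by
  induction hX with
  | edge p => exact edge _ _ hp
  | @node p h X _ ih =>
    rcases hA.vertex p h with h' | h'
    · convert fst p.1 p.2 (fun c => X (c, p.2)) hp h' (notMem_tVertices hS h') fun c hc =>
        have hI := (h'.2 (c, p.2)).2 ⟨hc, rfl⟩
        ih _ hI (A.mem_edges_of_In hI) using 1
      ext x
      constructor
      · rintro ⟨⟨c, d⟩, hq, hx⟩
        obtain ⟨hc, hd⟩ := (h'.2 _).1 hq
        obtain rfl : d = p.2 := hd
        exact ⟨c, hc, hx⟩
      · rintro ⟨c, hc, hx⟩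
        exact ⟨_, (h'.2 (c, p.2)).2 ⟨hc, rfl⟩, hx⟩
    · convert snd p.1 p.2 (fun d => X (p.1, d)) hp ⟨h, h'⟩ fun d hd =>
        have hI := (h'.2 (p.1, d)).2 ⟨rfl, hd⟩
        ih _ hI (A.mem_edges_of_In hI) using 1
      ext x
      constructor
      · rintro ⟨⟨c, d⟩, hq, hx⟩
        obtain ⟨hc, hd⟩ := (h'.2 _).1 hq
        obtain rfl : c = p.1 := hc
        exact ⟨d, hd, hx⟩
      · rintro ⟨d, hd, hx⟩
        exact ⟨_, (h'.2 (p.1, d)).2 ⟨rfl, hd⟩, hx⟩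

theorem comparable (hA : IsShuffle S T A) {p q : ES × ET} (hp : p ∈ A.edges) (hq : q ∈ A.edges)
    {m : ES × ET} (hpS : ReflTransGen S.In p.1 m.1) (hpT : ReflTransGen T.In p.2 m.2)
    (hqS : ReflTransGen S.In q.1 m.1) (hqT : ReflTransGen T.In q.2 m.2) :
    ReflTransGen A.In p q ∨ ReflTransGen A.In q p :=
  hA.isShuffleRel.comparable (A.reach p hp) (A.reach q hq) hpS hpT hqS hqT

/-! ### Faces over the part of `T` above an edge -/

section above

variable {x z : ET} (hA : IsShuffle S T A) (hS : S.IsOpen) (hz : T.In x z)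

include hA hS

theorem mem_shuffleOf_above {s : ES} {t : ET} (hp : (s, t) ∈ A.edges)
    (ht : ReflTransGen T.In z t) :
    (s, t) ∈ (shuffleOf S (T.above z (T.mem_edges_of_In hz)) (tVertices T A)).edges := by
  revert ht
  refine hA.edges_induction hS (P := fun s t => ReflTransGen T.In z t → (s, t) ∈
    (shuffleOf S (T.above z (T.mem_edges_of_In hz)) (tVertices T A)).edges) ?_ ?_ ?_ hp
  · intro ht
    rcases ReflTransGen.cases_tail ht with h | ⟨b, -, hb⟩
    · exact absurd (h ▸ hz) (T.not_In_root _)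
    · exact absurd hb (T.not_In_root _)
  · exact fun s t c _ _ hτ hc ih ht => mem_shuffleOf_fst (ih ht) hτ hc
  · intro s t d hp hτ hd ih ht
    rcases ReflTransGen.cases_tail ht with rfl | ⟨b, hzb, hb⟩
    · -- `(s, d)` is reached from the pair of roots by vertices of `S` only: the pairs `(a, d)`
      -- with `a` strictly below `s` are not edges of `A`, as they are not comparable to `(s, t)`.
      suffices H : ∀ a, ReflTransGen S.In S.root a → ReflTransGen S.In a s →
          (a, d) ∈ (shuffleOf S (T.above d (T.mem_edges_of_In hz)) (tVertices T A)).edges from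
        H s (S.reach s (hA.mem_edges hp).1) .refl
      intro a ha
      induction ha with
      | refl => exact fun _ => ReflTransGen.refl
      | @tail a c _ hac ih =>
        intro hcs
        refine mem_shuffleOf_fst (ih (.head hac hcs)) (fun ha => ?_) hac
        rcases hA.comparable (A.vert_subset ha.1) hp (m := (s, d)) (.head hac hcs) .refl .refl
          (.single hd) with h | h
        · exact T.not_reach_of_In hd (hA.isShuffleRel.reach h).2
        · exact S.not_reach_of_In hac (hcs.trans (hA.isShuffleRel.reach h).1)
    · obtain rfl := T.In_unique hb hd
      exact mem_shuffleOf_snd (ih hzb) hτ ⟨hd, hzb⟩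

theorem isLeafSet_shuffleOf_above {p : ES × ET} (hp : p ∈ A.edges) {X : Set (ES × ET)}
    (hX : A.IsLeafSet p X) (ht : ReflTransGen T.In z p.2) :
    (shuffleOf S (T.above z (T.mem_edges_of_In hz)) (tVertices T A)).IsLeafSet p X := by
  revert ht
  refine hA.isLeafSet_induction hS (P := fun s t X => ReflTransGen T.In z t →
    (shuffleOf S (T.above z (T.mem_edges_of_In hz)) (tVertices T A)).IsLeafSet (s, t) X)
    ?_ ?_ ?_ hp hX
  · exact fun s t _ _ => .edge _
  · intro s t X hp hv hτ ih ht
    exact isLeafSet_shuffleOf_fst (hA.mem_shuffleOf_above hS hz hp ht) hv.1 hτ X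
      fun c hc => ih c hc ht
  · intro s t X hp hτ ih ht
    convert isLeafSet_shuffleOf_snd (hA.mem_shuffleOf_above hS hz hp ht) ⟨hτ.2.1, ht⟩ hτ X
      fun d hd => ih d hd.1 (ht.tail hd.1) using 1
    ext x
    exact exists_congr fun d => and_congr_left fun _ => ⟨fun h => ⟨h, ht⟩, fun h => h.1⟩

theorem isFace_shuffleOf_above {F : RTree (ES × ET)} (hF : F.IsFace A)
    (hroot : ReflTransGen T.In z F.root.2) :
    F.IsFace (shuffleOf S (T.above z (T.mem_edges_of_In hz)) (tVertices T A)) := by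
  have h : ∀ p ∈ F.edges, ReflTransGen T.In z p.2 := fun p hp =>
    hroot.trans (hA.isShuffleRel.reach (hF.reach_root hp)).2
  refine hF.of_isLeafSet (fun p hp => hA.mem_shuffleOf_above hS hz (hF.edges_subset hp) (h p hp))
    fun p hp hX => ?_
  exact hA.isLeafSet_shuffleOf_above hS hz (hF.edges_subset (F.vert_subset hp)) hX
    (h p (F.vert_subset hp))

end above

/-! ### Faces over the part of `T` below a vertex -/

section below

variable {x y : ET} (hA : IsShuffle S T A) (hS : S.IsOpen) (hy : y ∉ T.vert) (hx : T.In x y)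

include hA hS

theorem mem_shuffleOf_below {s : ES} {t : ET} (hp : (s, t) ∈ A.edges)
    (ht : ¬ TransGen T.In x t) :
    (s, t) ∈ (shuffleOf S (T.below x (T.mem_vert_of_In hx)) (tVertices T A)).edges := by
  revert ht
  refine hA.edges_induction hS (P := fun s t => ¬ TransGen T.In x t → (s, t) ∈
    (shuffleOf S (T.below x (T.mem_vert_of_In hx)) (tVertices T A)).edges) ?_ ?_ ?_ hp
  · exact fun _ => ReflTransGen.refl
  · exact fun s t c _ _ hτ hc ih ht => mem_shuffleOf_fst (ih ht) hτ hc
  · intro s t d _ hτ hd ih ht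
    have h : ¬ ReflTransGen T.In x t := fun h => ht (.tail' h hd)
    exact mem_shuffleOf_snd (ih fun h' => h h'.to_reflTransGen) hτ ⟨hd, h⟩

include hy in
/-- Since `S` is open and `y` is a leaf, an operation with output in the column of `y` has an
input there.  So an operation with no input in the column of `y` does not contain any vertex
`s ⊗ v`, where `v` is the vertex `y` is attached to. -/
theorem isLeafSet_shuffleOf_below {p : ES × ET} (hp : p ∈ A.edges) {X : Set (ES × ET)}
    (hX : A.IsLeafSet p X) : (p.2 = y → ∃ q ∈ X, q.2 = y) ∧
      ((∀ q ∈ X, q.2 ≠ y) → ¬ TransGen T.In x p.2 →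
        (shuffleOf S (T.below x (T.mem_vert_of_In hx)) (tVertices T A)).IsLeafSet p X ∧
          ∀ q ∈ X, ¬ TransGen T.In x q.2) := by
  refine hA.isLeafSet_induction hS (P := fun s t X => (t = y → ∃ q ∈ X, q.2 = y) ∧
    ((∀ q ∈ X, q.2 ≠ y) → ¬ TransGen T.In x t →
    (shuffleOf S (T.below x (T.mem_vert_of_In hx)) (tVertices T A)).IsLeafSet (s, t) X ∧
      ∀ q ∈ X, ¬ TransGen T.In x q.2)) ?_ ?_ ?_ hp hX
  · refine fun s t _ => ⟨fun h => ⟨(s, t), rfl, h⟩, fun _ ht => ⟨.edge _, ?_⟩⟩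
    rintro q rfl
    exact ht
  · intro s t X hp hv hτ ih
    refine ⟨fun h => ?_, fun hXy ht => ?_⟩
    · obtain ⟨c, hc⟩ := hS _ hv.1
      obtain ⟨q, hq, hqy⟩ := (ih c hc).1 h
      exact ⟨q, ⟨c, hc, hq⟩, hqy⟩
    · have ih' := fun c hc => (ih c hc).2 (fun q hq => hXy q ⟨c, hc, hq⟩) ht
      refine ⟨isLeafSet_shuffleOf_fst (hA.mem_shuffleOf_below hS hx hp ht) hv.1 hτ X
        fun c hc => (ih' c hc).1, ?_⟩
      rintro q ⟨c, hc, hq⟩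
      exact (ih' c hc).2 q hq
  · intro s t X hp hτ ih
    refine ⟨fun h => absurd hτ.2.1 (h ▸ hy), fun hXy ht => ?_⟩
    have h : ¬ ReflTransGen T.In x t := fun h => by
      rcases reflTransGen_iff_eq_or_transGen.1 h with rfl | h
      · obtain ⟨q, hq, hqy⟩ := (ih y hx).1 rfl
        exact hXy q ⟨y, hx, hq⟩ hqy
      · exact ht h
    have hn : ∀ d, T.In t d → ¬ TransGen T.In x d := fun d hd h' => by
      obtain ⟨b, hb, hbd⟩ := TransGen.tail'_iff.1 h'
      exact h (T.In_unique hbd hd ▸ hb)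
    have ih' := fun d hd => (ih d hd).2 (fun q hq => hXy q ⟨d, hd, hq⟩) (hn d hd)
    constructor
    · convert isLeafSet_shuffleOf_snd (hA.mem_shuffleOf_below hS hx hp ht) ⟨hτ.2.1, h⟩ hτ X
        fun d hd => (ih' d hd.1).1 using 1
      ext x
      exact exists_congr fun d => and_congr_left fun _ => ⟨fun h' => ⟨h', h⟩, fun h => h.1⟩
    · rintro q ⟨d, hd, hq⟩
      exact (ih' d hd).2 q hq

include hy in
theorem isFace_shuffleOf_below {F : RTree (ES × ET)} (hF : F.IsFace A)
    (hFy : ∀ p ∈ F.edges, p.2 ≠ y) (hroot : ¬ TransGen T.In x F.root.2) :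
    F.IsFace (shuffleOf S (T.below x (T.mem_vert_of_In hx)) (tVertices T A)) := by
  have key := fun p (hp : p ∈ F.vert) =>
    (hA.isLeafSet_shuffleOf_below hS hy hx (hF.edges_subset (F.vert_subset hp))
      (hF.isLeafSet hp)).2 fun q hq => hFy q (F.mem_edges_of_In hq)
  have h : ∀ p ∈ F.edges, ¬ TransGen T.In x p.2 := fun p hp => by
    have hr := F.reach p hp
    clear hp
    induction hr with
    | refl => exact hroot
    | tail _ hbc ih => exact (key _ (F.mem_vert_of_In hbc) ih).2 _ hbc
  exact hF.of_isLeafSet (fun p hp => hA.mem_shuffleOf_below hS hx (hF.edges_subset hp) (h p hp))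
    fun p hp _ => (key p hp (h p (F.vert_subset hp))).1

end below

/-! ### Faces over the contraction of an internal edge -/

theorem notMem_edges_of_isSVertex (hA : IsShuffle S T A) {s : ES} {t d : ET}
    (hp : (s, t) ∈ A.edges) (hv : IsSVertex S A (s, t)) (hd : T.In t d) :
    (s, d) ∉ A.edges := fun hp' => by
  rcases hA.comparable hp hp' (m := (s, d)) .refl (.single hd) .refl .refl with h | h
  · rcases ReflTransGen.cases_head h with h | ⟨q, hq, h⟩
    · exact T.ne_of_In hd (congrArg Prod.snd h)
    · exact S.not_reach_of_In ((hv.2 q).1 hq).1 (hA.isShuffleRel.reach h).1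
  · exact T.not_reach_of_In hd (hA.isShuffleRel.reach h).2

section contract

variable {y : ET} (hA : IsShuffle S T A) (hS : S.IsOpen) (hy : T.IsInternal y)

include hA hS

/-- The second half says that the shuffle of `S ⊗ ∂_y T` has the edges `(s, e)`, for all inputs `e`
of the vertex on top of `y`, as soon as `A` has the edge `(s, y)`. -/
theorem mem_shuffleOf_contract {s : ES} {t : ET} (hp : (s, t) ∈ A.edges) :
    (t ≠ y → (s, t) ∈ (shuffleOf S (T.contract y hy) (tVertices T A)).edges) ∧
      (t = y → ∀ e, T.In y e →
        (s, e) ∈ (shuffleOf S (T.contract y hy) (tVertices T A)).edges) := by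
  refine hA.edges_induction hS (P := fun s t =>
    (t ≠ y → (s, t) ∈ (shuffleOf S (T.contract y hy) (tVertices T A)).edges) ∧
      (t = y → ∀ e, T.In y e →
        (s, e) ∈ (shuffleOf S (T.contract y hy) (tVertices T A)).edges)) ?_ ?_ ?_ hp
  · exact ⟨fun _ => ReflTransGen.refl, fun h => absurd h.symm hy.2⟩
  · intro s t c hp hv hτ hc ih
    refine ⟨fun h => mem_shuffleOf_fst (ih.1 h) hτ hc, ?_⟩
    rintro rfl e he
    exact mem_shuffleOf_fst (ih.2 rfl e he)
      (fun h => hA.notMem_edges_of_isSVertex hp hv he (A.vert_subset h.1)) hc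
  · intro s t d _ hτ hd ih
    constructor
    · intro hdy
      by_cases hty : t = y
      · exact ih.2 hty d (hty ▸ hd)
      · exact mem_shuffleOf_snd (ih.1 hty) hτ ⟨hty, hdy, .inl hd⟩
    · rintro rfl e he
      exact mem_shuffleOf_snd (ih.1 (T.ne_of_In hd)) hτ
        ⟨T.ne_of_In hd, (T.ne_of_In he).symm, .inr ⟨hd, he⟩⟩

open Classical in
/-- Let `w` be the vertex on top of `y`.  An operation of `A` with output `(s, y)` and with no input
in the column of `y` contains a vertex `s' ⊗ w` on top of each of the edges `(s', y)` at which it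
leaves that column; when `w` is removed from all these places, the operation falls apart into
operations of the shuffle of `S ⊗ ∂_y T` with outputs `(s, e)`, for the inputs `e` of `w`. -/
theorem isLeafSet_shuffleOf_contract {p : ES × ET} (hp : p ∈ A.edges) {X : Set (ES × ET)}
    (hX : A.IsLeafSet p X) : (∀ q ∈ X, q.2 ≠ y) →
      (p.2 ≠ y → (shuffleOf S (T.contract y hy) (tVertices T A)).IsLeafSet p X) ∧
      (p.2 = y → ∃ Y : ET → Set (ES × ET), (∀ e, T.In y e →
        (shuffleOf S (T.contract y hy) (tVertices T A)).IsLeafSet (p.1, e) (Y e)) ∧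
        X = {x | ∃ e, T.In y e ∧ x ∈ Y e}) := by
  refine hA.isLeafSet_induction hS (P := fun s t X => (∀ q ∈ X, q.2 ≠ y) →
      (t ≠ y → (shuffleOf S (T.contract y hy) (tVertices T A)).IsLeafSet (s, t) X) ∧
      (t = y → ∃ Y : ET → Set (ES × ET), (∀ e, T.In y e →
        (shuffleOf S (T.contract y hy) (tVertices T A)).IsLeafSet (s, e) (Y e)) ∧
        X = {x | ∃ e, T.In y e ∧ x ∈ Y e})) ?_ ?_ ?_ hp hX
  · exact fun s t _ h => ⟨fun _ => .edge _, fun h' => absurd h' (h (s, t) rfl)⟩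
  · intro s t X hp hv hτ ih hXy
    replace ih := fun c hc => ih c hc fun q hq => hXy q ⟨c, hc, hq⟩
    refine ⟨fun h => isLeafSet_shuffleOf_fst ((hA.mem_shuffleOf_contract hS hy hp).1 h) hv.1 hτ X
      fun c hc => (ih c hc).1 h, ?_⟩
    rintro rfl
    have ih' : ∀ c, ∃ Y : ET → Set (ES × ET), S.In s c → (∀ e, T.In t e →
        (shuffleOf S (T.contract t hy) (tVertices T A)).IsLeafSet (c, e) (Y e)) ∧
        X c = {x | ∃ e, T.In t e ∧ x ∈ Y e} := fun c => by
      by_cases hc : S.In s c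
      · obtain ⟨Y, hY⟩ := (ih c hc).2 rfl
        exact ⟨Y, fun _ => hY⟩
      · exact ⟨fun _ => ∅, fun h => absurd h hc⟩
    choose Y hY using ih'
    refine ⟨fun e => {x | ∃ c, S.In s c ∧ x ∈ Y c e}, fun e he => ?_, ?_⟩
    · exact isLeafSet_shuffleOf_fst ((hA.mem_shuffleOf_contract hS hy hp).2 rfl e he) hv.1
        (fun h => hA.notMem_edges_of_isSVertex hp hv he (A.vert_subset h.1)) (fun c => Y c e)
        fun c hc => (hY c hc).1 e he
    · ext x
      constructor
      · rintro ⟨c, hc, hx⟩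
        rw [(hY c hc).2] at hx
        obtain ⟨e, he, hx⟩ := hx
        exact ⟨e, he, c, hc, hx⟩
      · rintro ⟨e, he, c, hc, hx⟩
        refine ⟨c, hc, ?_⟩
        rw [(hY c hc).2]
        exact ⟨e, he, hx⟩
  · intro s t X hp hτ ih hXy
    replace ih := fun d hd => ih d hd fun q hq => hXy q ⟨d, hd, hq⟩
    constructor
    · intro hty
      have hB := (hA.mem_shuffleOf_contract hS hy hp).1 hty
      by_cases h : T.In t y
      · obtain ⟨Y, hY, hXY⟩ := (ih y h).2 rfl
        convert isLeafSet_shuffleOf_snd hB ⟨hτ.2.1, hty⟩ hτ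
          (fun d => if T.In t d then X d else Y d) ?_ using 1
        · ext x
          constructor
          · rintro ⟨d, hd, hx⟩
            by_cases hdy : d = y
            · subst hdy
              rw [hXY] at hx
              obtain ⟨e, he, hx⟩ := hx
              refine ⟨e, ⟨hty, (T.ne_of_In he).symm, .inr ⟨h, he⟩⟩, ?_⟩
              rwa [if_neg fun h' => hty (T.In_unique h' he)]
            · refine ⟨d, ⟨hty, hdy, .inl hd⟩, ?_⟩
              rwa [if_pos hd]
          · rintro ⟨d, ⟨-, -, hd⟩, hx⟩
            split_ifs at hx with h'
            · exact ⟨d, h', hx⟩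
            · refine ⟨y, h, ?_⟩
              rw [hXY]
              exact ⟨d, (hd.resolve_left h').2, hx⟩
        · rintro d ⟨-, hdy, hd⟩
          split_ifs with h'
          · exact (ih d h').1 hdy
          · exact hY d (hd.resolve_left h').2
      · convert isLeafSet_shuffleOf_snd hB ⟨hτ.2.1, hty⟩ hτ X ?_ using 1
        · ext x
          refine exists_congr fun d => and_congr_left fun _ => ⟨fun hd => ?_, fun hd => ?_⟩
          · exact ⟨hty, fun hdy => h (hdy ▸ hd), .inl hd⟩
          · exact hd.2.2.resolve_right fun h' => h h'.1
        · exact fun d hd => (ih d (hd.2.2.resolve_right fun h' => h h'.1)).1 hd.2.1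
    · rintro rfl
      exact ⟨X, fun e he => (ih e he).1 (T.ne_of_In he).symm, rfl⟩

theorem isFace_shuffleOf_contract {F : RTree (ES × ET)} (hF : F.IsFace A)
    (hFy : ∀ p ∈ F.edges, p.2 ≠ y) :
    F.IsFace (shuffleOf S (T.contract y hy) (tVertices T A)) :=
  hF.of_isLeafSet
    (fun p hp => (hA.mem_shuffleOf_contract hS hy (hF.edges_subset hp)).1 (hFy p hp))
    fun p hp hX => (hA.isLeafSet_shuffleOf_contract hS hy (hF.edges_subset (F.vert_subset hp)) hX
      fun q hq => hFy q (F.mem_edges_of_In hq)).1 (hFy p (F.vert_subset hp))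

end contract

/-! ### Containment for open `S` -/

theorem containedInD (hA : IsShuffle S T A) (hS : S.IsOpen) {y : ET} (hy : y ∈ T.edges)
    {F : RTree (ES × ET)} (hF : F.IsFace A) (hFy : ∀ p ∈ F.edges, p.2 ≠ y) :
    ContainedInD hA hF y := by
  have hr := hFy _ F.root_mem
  have hrT := (hA.mem_edges (hF.edges_subset F.root_mem)).2
  by_cases hroot : y = T.root
  · rcases ReflTransGen.cases_head (T.reach _ hrT) with h | ⟨z, hz, h⟩
    · exact absurd (hroot.trans h).symm hr
    · exact ⟨_, .input hroot (hroot ▸ hz), .of_isFace hA hF _ (isShuffle_shuffleOf _ _ _)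
        (hA.isFace_shuffleOf_above hS hz hF h)⟩
  by_cases hv : y ∈ T.vert
  · exact ⟨_, .internal ⟨hv, hroot⟩, .of_isFace hA hF _ (isShuffle_shuffleOf _ _ _)
      (hA.isFace_shuffleOf_contract hS ⟨hv, hroot⟩ hF hFy)⟩
  · obtain ⟨x, -, hx⟩ := (ReflTransGen.cases_tail (T.reach _ hy)).resolve_left hroot
    by_cases h : TransGen T.In x F.root.2
    · obtain ⟨z, hz, h⟩ := TransGen.head'_iff.1 h
      have hzy : z ≠ y := by
        rintro rfl
        -- nothing lies above the leaf `z`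
        rcases ReflTransGen.cases_head h with h | ⟨c, hc, -⟩
        · exact hr h.symm
        · exact hv (T.mem_vert_of_In hc)
      exact ⟨_, .sibling ⟨hy, hv⟩ hx hz hzy, .of_isFace hA hF _ (isShuffle_shuffleOf _ _ _)
        (hA.isFace_shuffleOf_above hS hz hF h)⟩
    · exact ⟨_, .base ⟨hy, hv⟩ hx, .of_isFace hA hF _ (isShuffle_shuffleOf _ _ _)
        (hA.isFace_shuffleOf_below hS hv hx hF hFy h)⟩

end IsShuffle

/-! ### A counterexample for `S` with a bald vertex -/

/-- The tree with a single edge and a bald vertex on top of it. -/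
def stump : RTree Unit where
  edges := Set.univ
  finite_edges := Set.toFinite _
  root := ()
  root_mem := trivial
  vert := Set.univ
  vert_subset _ h := h
  In _ _ := False
  mem_vert_of_In h := h.elim
  mem_edges_of_In h := h.elim
  In_unique h := h.elim
  not_In_root _ h := h
  reach _ _ := .refl

/-- The corolla with root edge `0` and leaves `1` and `2`. -/
def binaryCorolla : RTree (Fin 3) where
  edges := Set.univ
  finite_edges := Set.toFinite _
  root := 0
  root_mem := trivial
  vert := {0}
  vert_subset _ _ := trivial
  In e c := e = 0 ∧ c ≠ 0
  mem_vert_of_In h := h.1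
  mem_edges_of_In _ := trivial
  In_unique h h' := h.1.trans h'.1.symm
  not_In_root _ h := h.2 rfl
  reach e _ := by
    by_cases h : e = 0
    · exact h ▸ .refl
    · exact .single ⟨rfl, h⟩

/-- The shuffle of `stump ⊗ binaryCorolla` with the binary vertex at the root and a bald vertex on
top of each of its inputs. -/
def bottomShuffle : RTree (Unit × Fin 3) where
  edges := Set.univ
  finite_edges := Set.toFinite _
  root := ((), 0)
  root_mem := trivial
  vert := Set.univ
  vert_subset _ h := h
  In p q := p.2 = 0 ∧ q.2 ≠ 0
  mem_vert_of_In _ := trivial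
  mem_edges_of_In _ := trivial
  In_unique h h' := Prod.ext rfl (h.1.trans h'.1.symm)
  not_In_root _ h := h.2 rfl
  reach p _ := by
    by_cases h : p.2 = 0
    · obtain rfl : p = ((), 0) := Prod.ext rfl h
      exact .refl
    · exact .single ⟨rfl, h⟩

theorem isShuffle_bottomShuffle : IsShuffle stump binaryCorolla bottomShuffle where
  root_eq := rfl
  leaf _ hp := absurd trivial hp.2
  vertex p _ := by
    by_cases h : p.2 = 0
    · exact .inr ⟨h, fun q => ⟨fun hq => ⟨rfl, hq⟩, fun hq => hq.2⟩⟩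
    · exact .inl ⟨trivial, fun q => ⟨fun hq => absurd hq.1 h, fun hq => hq.1.elim⟩⟩

/-- The unary corolla with root edge `(*, 0)` and leaf `(*, 2)`: the face of `bottomShuffle` in
which the input `(*, 1)` of the binary vertex is closed off by a bald vertex. -/
def unaryFace : RTree (Unit × Fin 3) where
  edges := {p | p.2 ≠ 1}
  finite_edges := Set.toFinite _
  root := ((), 0)
  root_mem := by decide
  vert := {((), 0)}
  vert_subset := by rintro _ rfl; decide
  In p q := p = ((), 0) ∧ q = ((), 2)
  mem_vert_of_In h := h.1
  mem_edges_of_In := by rintro _ _ ⟨-, rfl⟩; decide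
  In_unique h h' := h.1.trans h'.1.symm
  not_In_root _ h := absurd h.2 (by decide)
  reach := by
    rintro ⟨⟨⟩, e⟩ he
    fin_cases e
    · exact .refl
    · exact absurd rfl he
    · exact .single ⟨rfl, rfl⟩

theorem isFace_unaryFace : unaryFace.IsFace bottomShuffle where
  edges_subset _ _ := trivial
  exists_op := by
    rintro _ rfl
    refine isLeafSet_iff.1 ?_
    convert IsLeafSet.node (T := bottomShuffle) (e := ((), 0)) trivial
      (fun q => {x | q.2 = 2 ∧ x = q}) ?_ using 1
    · ext x
      constructor
      · rintro ⟨-, rfl⟩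
        exact ⟨((), 2), ⟨rfl, by decide⟩, rfl, rfl⟩
      · rintro ⟨q, -, hq, rfl⟩
        exact ⟨rfl, Prod.ext rfl hq⟩
    · rintro q ⟨-, hq⟩
      by_cases h : q.2 = 2
      · convert IsLeafSet.edge (T := bottomShuffle) q using 1
        ext x
        exact ⟨fun hx => hx.2, fun hx => ⟨h, hx⟩⟩
      · convert IsLeafSet.node (T := bottomShuffle) (e := q) trivial (fun _ => ∅)
          (fun c hc => absurd hc.1 hq) using 1
        ext x
        exact ⟨fun hx => absurd hx.1 h, fun ⟨c, _, hx⟩ => hx.elim⟩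

/-- The components of `D_1 binaryCorolla` are the single edges `0` and `2`, whereas `unaryFace` has
edges over both of them. -/
theorem not_containedInD_unaryFace :
    ¬ ContainedInD isShuffle_bottomShuffle isFace_unaryFace 1 := by
  rintro ⟨R, hR, B, hB, hFB, -⟩
  have h0 : (0 : Fin 3) ∈ R.edges :=
    (hB.mem_edges (hFB.edges_subset (show ((), 0) ∈ unaryFace.edges from unaryFace.root_mem))).2
  have h2 : (2 : Fin 3) ∈ R.edges :=
    (hB.mem_edges (hFB.edges_subset (unaryFace.mem_edges_of_In (c := ((), 2)) ⟨rfl, rfl⟩))).2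
  cases hR with
  | internal hy => exact absurd (show (1 : Fin 3) = 0 from hy.1) (by decide)
  | sibling _ _ hz _ => exact binaryCorolla.not_reach_of_In ⟨rfl, hz.2⟩ h0
  | base _ hx => exact h2.2 (.single ⟨hx.1, by decide⟩)
  | input hy _ => exact absurd hy (by decide)

end Dendro

theorem mainTheorem7 :
    (∀ {ES : Type*} {ET : Type*} (S : Dendro.RTree ES) (T : Dendro.RTree ET) (_ : S.IsOpen)
      (y : ET) (_ : y ∈ T.edges) (A : Dendro.RTree (ES × ET)) (hA : Dendro.IsShuffle S T A)
      (F : Dendro.RTree (ES × ET)) (hF : F.IsFace A) (_ : ∀ p ∈ F.edges, p.2 ≠ y),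
      Dendro.ContainedInD hA hF y) ∧
    (∃ (ES ET : Type) (S : Dendro.RTree ES) (T : Dendro.RTree ET) (y : ET)
      (A : Dendro.RTree (ES × ET)) (hA : Dendro.IsShuffle S T A)
      (F : Dendro.RTree (ES × ET)) (hF : F.IsFace A),
      ¬ S.IsOpen ∧ y ∈ T.edges ∧ (∀ p ∈ F.edges, p.2 ≠ y) ∧ ¬ Dendro.ContainedInD hA hF y) :=
  ⟨fun _ _ hS _ hy _ hA _ hF hFy => hA.containedInD hS hy hF hFy,
    Unit, Fin 3, Dendro.stump, Dendro.binaryCorolla, 1, Dendro.bottomShuffle,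
    Dendro.isShuffle_bottomShuffle, Dendro.unaryFace, Dendro.isFace_unaryFace,
    fun h => (h () trivial).choose_spec, trivial, fun _ h => h,
    Dendro.not_containedInD_unaryFace⟩
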